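/- For $v=(v_0,v_1,v_2)\in(\mathbb{Q}^\times)^3$, $w=(w_1,w_2)\in\mathbb{Z}^2$ and $M=\begin{pmatrix}a&b\\c&d\end{pmatrix}\in\operatorname{GL}_2(\mathbb{Z})$, and for a Laurent polynomial $P\in\mathbb{Q}[x^{\pm1},y^{\pm1}]$, put $$v\ast P:=v_0\,P(v_1x,v_2y),\qquad w\ast P:=x^{w_1}y^{w_2}P,\qquad M\ast P:=P(x^ay^b,x^cy^d),$$ and $P_\alpha:=v\ast(w\ast(M\ast P))$ for $\alpha=(v,w,M)$. For a nonzero $P$ let $V_P(\mathbb{C})=\{(x,y)\in(\mathbb{C}^\times)^2: P(x,y)=0\}$, let $V_P^{\mathrm{sing}}(\mathbb{C})$ be the set of singular points of the zero locus $V_P$ (with its reduced structure), let $\gamma_P:=\{(x,y)\in V_P(\mathbb{C}): |x|=1,\ |y|\le 1\}$ be Deninger's path, and let $\mathbb{T}^2=\{(x,y)\in(\mathbb{C}^\times)^2: |x|=|y|=1\}$. Let $Q\in\mathbb{Q}[x^{\pm1},y^{\pm1}]$ be a nonzero Laurent polynomial. Then there exists $\alpha\in(\mathbb{Q}^\times)^3\times\mathbb{Z}^2\times\operatorname{GL}_2(\mathbb{Z})$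 such that $$Q_\alpha\in 1+y\,\mathbb{Z}[x,y],\qquad V_{Q_\alpha}(\mathbb{C})\cap\mathbb{T}^2=\emptyset,\qquad \gamma_{Q_\alpha}\cap V_{Q_\alpha}^{\mathrm{sing}}(\mathbb{C})=\emptyset .$$ -/

import Mathlib

noncomputable section

/-- The ring `R[x₁^{±1}, …, xₙ^{±1}]` of Laurent polynomials in `n` variables. -/
abbrev LaurentPoly (R : Type*) [CommRing R] (n : ℕ) : Type _ :=
  AddMonoidAlgebra R (Fin n → ℤ)

namespace LaurentPoly

/-- The monomial `x^z = x₁^{z₁} ⋯ xₙ^{zₙ}`, as a unit of the Laurent polynomial ring. -/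
def mono (R : Type*) [CommRing R] {n : ℕ} (z : Fin n → ℤ) : (LaurentPoly R n)ˣ where
  val := AddMonoidAlgebra.single z 1
  inv := AddMonoidAlgebra.single (-z) 1
  val_inv := by
    rw [AddMonoidAlgebra.single_mul_single, add_neg_cancel, one_mul, AddMonoidAlgebra.one_def]
  inv_val := by
    rw [AddMonoidAlgebra.single_mul_single, neg_add_cancel, one_mul, AddMonoidAlgebra.one_def]

/-- The variable `xᵢ`. -/
def X (R : Type*) [CommRing R] {n : ℕ} (i : Fin n) : (LaurentPoly R n)ˣ :=
  mono R (Pi.single i 1)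

/-- The value `P(u₁, …, uₙ)` of a Laurent polynomial at units `u₁, …, uₙ` of an `R`-algebra. -/
def subst {R A : Type*} [CommRing R] [CommRing A] [Algebra R A] {n : ℕ} (u : Fin n → Aˣ) :
    LaurentPoly R n →ₐ[R] A :=
  AddMonoidAlgebra.lift R A (Fin n → ℤ)
    { toFun := fun z => ((∏ i, u i ^ (Multiplicative.toAdd z i) : Aˣ) : A)
      map_one' := by simp
      map_mul' := fun z w => by
        rw [← Units.val_mul, ← Finset.prod_mul_distrib]
        simp [zpow_add] }

/-- The formal partial derivative `∂P/∂xᵢ`: it sends `c x^z` to `zᵢ c x^{z - eᵢ}`. -/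
def pderiv {R : Type*} [CommRing R] {n : ℕ} (i : Fin n) (P : LaurentPoly R n) :
    LaurentPoly R n :=
  P.coeff.sum fun z c => AddMonoidAlgebra.single (z - Pi.single i 1) ((z i : R) * c)

/-- The parameters `(v, w, M) ∈ (Rˣ)^{n+1} × (ℤⁿ ⋊ GLₙ(ℤ))` of a transformation of Laurent
polynomials. -/
structure Transformation (R : Type*) [CommRing R] (n : ℕ) where
  /-- The scaling factors `(v₀, v₁, …, vₙ)`. -/
  v : Fin (n + 1) → Rˣ
  /-- The exponent of the monomial factor. -/
  w : Fin n → ℤ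
  /-- The monomial change of variables. -/
  M : Matrix.GeneralLinearGroup (Fin n) ℤ

/-- `v ∗ P = v₀ P(v₁ x₁, …, vₙ xₙ)`. -/
def scale {R : Type*} [CommRing R] {n : ℕ} (v : Fin (n + 1) → Rˣ) (P : LaurentPoly R n) :
    LaurentPoly R n :=
  (v 0 : R) • subst (fun i => Units.map (algebraMap R (LaurentPoly R n)) (v i.succ) * X R i) P

/-- `w ∗ P = x^w P`. -/
def shift {R : Type*} [CommRing R] {n : ℕ} (w : Fin n → ℤ) (P : LaurentPoly R n) :
    LaurentPoly R n :=
  (mono R w : LaurentPoly R n) * P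

/-- `M ∗ P = P(x^{m₁}, …, x^{mₙ})`, where `m₁, …, mₙ` are the rows of `M`. -/
def changeVars {R : Type*} [CommRing R] {n : ℕ} (M : Matrix.GeneralLinearGroup (Fin n) ℤ)
    (P : LaurentPoly R n) : LaurentPoly R n :=
  subst (fun i => mono R ((M : Matrix (Fin n) (Fin n) ℤ) i)) P

/-- The transformed polynomial `P_α = v ∗ (w ∗ (M ∗ P))` for `α = (v, w, M)`. -/
def Transformation.act {R : Type*} [CommRing R] {n : ℕ} (α : Transformation R n)
    (P : LaurentPoly R n) : LaurentPoly R n :=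
  scale α.v (shift α.w (changeVars α.M P))

/-- The complex points `V_P(ℂ)` of the zero locus of `P` inside `𝔾ₘⁿ`. -/
def zeroLocus {R : Type*} [CommRing R] [Algebra R ℂ] {n : ℕ} (P : LaurentPoly R n) :
    Set (Fin n → ℂˣ) :=
  {u | subst u P = 0}

/-- The singular complex points of the zero locus `V_P ⊆ 𝔾ₘⁿ` of a nonzero Laurent polynomial
`P`, by the Jacobian criterion. The variety `V_P` is empty or of pure codimension one, so a point
of it is regular exactly when some Laurent polynomial that vanishes identically on `V_P(ℂ)` has a
nonzero gradient there. The whole vanishing ideal is used, so that `V_P` is the zero locus with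
its reduced structure and repeated factors of `P` do not matter. -/
def singularLocus {R : Type*} [CommRing R] [Algebra R ℂ] {n : ℕ} (P : LaurentPoly R n) :
    Set (Fin n → ℂˣ) :=
  {u | u ∈ zeroLocus P ∧
    ∀ F : LaurentPoly ℂ n, (∀ t ∈ zeroLocus P, subst t F = 0) →
      ∀ i, subst u (pderiv i F) = 0}

/-- The real unit torus `𝕋ⁿ ⊆ 𝔾ₘⁿ(ℂ)`. -/
def unitTorus (n : ℕ) : Set (Fin n → ℂˣ) :=
  {u | ∀ i, ‖(u i : ℂ)‖ = 1}

/-- Deninger's path `γ_P = {(x, y) ∈ V_P(ℂ) : |x| = 1, |y| ≤ 1}`. -/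
def deningerPath {R : Type*} [CommRing R] [Algebra R ℂ] (P : LaurentPoly R 2) :
    Set (Fin 2 → ℂˣ) :=
  {u | u ∈ zeroLocus P ∧ ‖(u 0 : ℂ)‖ = 1 ∧ ‖(u 1 : ℂ)‖ ≤ 1}

/-- The set `1 + y ℤ[x, y]` inside `ℚ[x^{±1}, y^{±1}]`. -/
def onePlusYIntPoly : Set (LaurentPoly ℚ 2) :=
  {P | ∃ F : MvPolynomial (Fin 2) ℤ,
    P = 1 + (X ℚ (1 : Fin 2) : LaurentPoly ℚ 2) *
      MvPolynomial.aeval (fun i => (X ℚ i : LaurentPoly ℚ 2)) F}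

end LaurentPoly

end

/-!
A monomial change of variables moves one vertex of the Newton polygon of `Q` to the origin and all
other exponents into `{(i, j) | 0 ≤ i, 0 < j}`, so we may take `Q = p` with
`p = c + y H`, `c ≠ 0` and `H` a polynomial. Only finitely many `x` are zeros of the leading
coefficient of `p` in `y`, or lie below a singular point of the curve: if `F` is the squarefree part
of `p`, there is a Bézout identity `A F + B ∂F/∂y = r(x)` with `r ≠ 0`, and a singular point would
be a common zero of `F` and `∂F/∂y`. So for a large integer `n` the circle `|x| = n` avoids all of
them, and by compactness the zeros of `p` above that circle satisfy `|y| < T` for some `T`.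
Replacing `(x, y)` by `(n x, N y)` turns this circle into `|x| = 1`, and any `N ≥ T` moves the zeros
above it into `|y| < 1`. If `N` is moreover a multiple of a common denominator of `c⁻¹ H`,
then `c⁻¹ p(n x, N y)` lies in `1 + y ℤ[x, y]`.
-/

section Polynomial

open Polynomial
open scoped Polynomial.Bivariate

section IsLocalization

variable {R : Type*} [CommRing R]

theorem exists_map_eq_C_mul (M : Submonoid R) {S : Type*} [CommRing S] [Algebra R S]
    [IsLocalization M S] (q : S[X]) :
    ∃ b ∈ M, ∃ Q : R[X], Q.map (algebraMap R S) = C (algebraMap R S b) * q := by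
  obtain ⟨b, hb, hQ⟩ := IsLocalization.integerNormalization_spec M q
  exact ⟨b, hb, _, by rw [hQ, algebra_compatible_smul S b q, smul_eq_C_mul]⟩

attribute [local instance] Polynomial.algebra Polynomial.isLocalization in
theorem exists_map_mapRingHom_eq_CC_mul (M : Submonoid R) {S : Type*} [CommRing S] [Algebra R S]
    [IsLocalization M S] (q : S[X][Y]) :
    ∃ b ∈ M, ∃ Q : R[X][Y],
      Q.map (mapRingHom (algebraMap R S)) = C (C (algebraMap R S b)) * q := by
  obtain ⟨_, ⟨b, hb, rfl⟩, Q, hQ⟩ := exists_map_eq_C_mul (M.map C) q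
  exact ⟨b, hb, Q, by simpa using hQ⟩

variable [IsDomain R] (K : Type*) [Field K] [Algebra R K] [IsFractionRing R K] {P G : R[X]}

theorem exists_dvd_C_mul_of_map_dvd_map
    (h : P.map (algebraMap R K) ∣ G.map (algebraMap R K)) : ∃ e ≠ 0, P ∣ C e * G := by
  obtain ⟨t, ht⟩ := h
  obtain ⟨e, he, T, hT⟩ := exists_map_eq_C_mul (nonZeroDivisors R) t
  refine ⟨e, nonZeroDivisors.ne_zero he, T, ?_⟩
  apply map_injective _ (IsFractionRing.injective R K)
  rw [Polynomial.map_mul, Polynomial.map_mul, map_C, hT, ht]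
  ring

theorem exists_mul_add_mul_eq_C_of_isCoprime_map
    (h : IsCoprime (P.map (algebraMap R K)) (G.map (algebraMap R K))) :
    ∃ A B r, r ≠ 0 ∧ A * P + B * G = C r := by
  obtain ⟨a, b, hab⟩ := h
  obtain ⟨d, hd, A, hA⟩ := exists_map_eq_C_mul (nonZeroDivisors R) a
  obtain ⟨e, he, B, hB⟩ := exists_map_eq_C_mul (nonZeroDivisors R) b
  refine ⟨C e * A, C d * B, d * e,
    mul_ne_zero (nonZeroDivisors.ne_zero hd) (nonZeroDivisors.ne_zero he), ?_⟩
  apply map_injective _ (IsFractionRing.injective R K)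
  simp only [Polynomial.map_add, Polynomial.map_mul, map_C, hA, hB, map_mul]
  linear_combination C (algebraMap R K d) * C (algebraMap R K e) * hab

end IsLocalization

theorem exists_separable_dvd_pow {K : Type*} [Field K] [PerfectField K] {p : K[X]} (hp : p ≠ 0) :
    ∃ s : K[X], s.Separable ∧ ∃ n, p ∣ s ^ n := by
  classical
  exact ⟨UniqueFactorizationMonoid.radical p,
    PerfectField.separable_iff_squarefree.2 UniqueFactorizationMonoid.squarefree_radical,
    UniqueFactorizationMonoid.exists_dvd_radical_self_pow hp⟩

theorem exists_dvd_pow_and_mul_add_mul_derivative_eq_C {R : Type*} [CommRing R] [IsDomain R]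
    [CharZero R] {P : R[X]} (hP : P ≠ 0) :
    ∃ F : R[X], (∃ n, P ∣ F ^ n) ∧ ∃ A B r, r ≠ 0 ∧ A * F + B * derivative F = C r := by
  let K := FractionRing R
  have hinj : Function.Injective (algebraMap R K) := IsFractionRing.injective R K
  obtain ⟨s, hs, n, hsn⟩ :=
    exists_separable_dvd_pow ((Polynomial.map_ne_zero_iff hinj).2 hP)
  obtain ⟨b, hb, S, hS⟩ := exists_map_eq_C_mul (nonZeroDivisors R) s
  have hSsep : (S.map (algebraMap R K)).Separable := by
    have hbK : IsUnit (C (algebraMap R K b)) :=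
      isUnit_C.2 (IsLocalization.map_units K ⟨b, hb⟩)
    rw [hS]
    exact hs.unit_mul hbK
  have hdvd : P.map (algebraMap R K) ∣ (S ^ n).map (algebraMap R K) := by
    rw [Polynomial.map_pow, hS, mul_pow]
    exact hsn.mul_left _
  obtain ⟨e, he, hPS⟩ := exists_dvd_C_mul_of_map_dvd_map K hdvd
  obtain ⟨A, B, r, hr, hAB⟩ := exists_mul_add_mul_eq_C_of_isCoprime_map K
    (G := derivative S) (by simpa [Separable, derivative_map] using hSsep)
  refine ⟨C e * S, ⟨n + 1, ?_⟩, A, B, e * r, mul_ne_zero he hr, ?_⟩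
  · exact (hPS.mul_left (C e ^ n * S)).trans (dvd_of_eq (by ring))
  · rw [derivative_C_mul, map_mul, ← hAB]
    ring

theorem C_C_add_Y_mul_ne_zero {R : Type*} [CommRing R] {c : R} (hc : c ≠ 0) (H : R[X][Y]) :
    C (C c) + Y * H ≠ 0 := fun h =>
  hc (by simpa using congrArg (fun p : R[X][Y] => (p.coeff 0).coeff 0) h)

theorem eval_map_aeval {R A : Type*} [CommRing R] [CommRing A] [Algebra R A] (p : R[X][Y])
    (x y : A) : (p.map (aeval x : R[X] →ₐ[R] A).toRingHom).eval y = aevalAeval x y p := by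
  induction p using Polynomial.induction_on' with
  | add p q hp hq => simp_all
  | monomial n a => simp

theorem map_aevalAeval {R A B : Type*} [CommRing R] [CommRing A] [CommRing B] [Algebra R A]
    [Algebra R B] (f : A →ₐ[R] B) (x y : A) (p : R[X][Y]) :
    f (aevalAeval x y p) = aevalAeval (f x) (f y) p := by
  have h : f.comp (aevalAeval x y) = aevalAeval (f x) (f y) := by
    ext <;> simp
  exact DFunLike.congr_fun h p

theorem aevalAeval_map_mapRingHom {R S A : Type*} [CommRing R] [CommRing S] [CommRing A]
    [Algebra R S] [Algebra S A] [Algebra R A] [IsScalarTower R S A] (x y : A) (p : R[X][Y]) :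
    aevalAeval x y (p.map (mapRingHom (algebraMap R S))) = aevalAeval x y p := by
  induction p using Polynomial.induction_on' with
  | add p q hp hq => simp_all
  | monomial n a => simp

theorem exists_forall_eval_map_eq_zero_norm_lt {α B K : Type*} [TopologicalSpace α] [CommRing B]
    [NormedField K] {s : Set α} (hs : IsCompact s) (φ : α → B →+* K)
    (hφ : ∀ b, ContinuousOn (fun x => φ x b) s) (p : B[X])
    (hp : ∀ x ∈ s, φ x p.leadingCoeff ≠ 0) :
    ∃ T : ℝ, ∀ x ∈ s, ∀ y, (p.map (φ x)).eval y = 0 → ‖y‖ < T := by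
  have hcauchy : ∀ x ∈ s, (p.map (φ x)).cauchyBound =
      ((Finset.range p.natDegree).sup fun i => ‖φ x (p.coeff i)‖₊) /
        ‖φ x p.leadingCoeff‖₊ + 1 := by
    intro x hx
    simp only [cauchyBound, leadingCoeff, natDegree_map_of_leadingCoeff_ne_zero _ (hp x hx),
      coeff_map]
  have hcont : ContinuousOn (fun x => (p.map (φ x)).cauchyBound) s := by
    refine ContinuousOn.congr (ContinuousOn.add (ContinuousOn.div ?_ (hφ _).nnnorm ?_)
      continuousOn_const) hcauchy
    · exact ContinuousOn.finset_sup_apply fun i _ => (hφ _).nnnorm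
    · exact fun x hx => nnnorm_ne_zero_iff.2 (hp x hx)
  obtain ⟨T, hT⟩ := (hs.image_of_continuousOn hcont).bddAbove
  refine ⟨T, fun x hx y hy => ?_⟩
  have hne : p.map (φ x) ≠ 0 := fun h => hp x hx (by rw [leadingCoeff, ← coeff_map, h, coeff_zero])
  exact (IsRoot.norm_lt_cauchyBound hne hy).trans_le (hT ⟨x, hx, rfl⟩)

theorem exists_nat_forall_norm_eq_aeval_ne_zero {R K : Type*} [CommRing R] [IsDomain R]
    [NormedField K] [Algebra R K] [FaithfulSMul R K] {g : R[X]} (hg : g ≠ 0) :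
    ∃ n : ℕ, n ≠ 0 ∧ ∀ x : K, ‖x‖ = n → aeval x g ≠ 0 := by
  obtain ⟨r, hr⟩ := (g.rootSet_finite K).isBounded.exists_norm_le
  obtain ⟨n, hn⟩ := exists_nat_gt (max r 0)
  refine ⟨n, ?_, fun x hx hgx => ?_⟩
  · rintro rfl
    simp at hn
  · have hxr : ‖x‖ ≤ r := hr x ((mem_rootSet_of_ne hg).2 hgx)
    linarith [le_max_left r 0]

end Polynomial

section Lattice

open scoped Matrix

theorem eq_zero_of_mul_add_eq_zero_of_abs_lt {N a b : ℤ} (hb : |b| < N) (h : N * a + b = 0) :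
    a = 0 ∧ b = 0 := by
  have hb₀ : b = 0 := Int.eq_zero_of_abs_lt_dvd ⟨-a, by linarith⟩ hb
  have hN : N ≠ 0 := ((abs_nonneg b).trans_lt hb).ne'
  exact ⟨by simpa [hb₀, hN] using h, hb₀⟩

theorem vecMul_one_add_mul_self {R : Type*} [CommRing R] (N : R) (d : Fin 2 → R) :
    d ᵥ* !![1 + N * N, N; N, 1] = ![d 0 + N * (N * d 0 + d 1), N * d 0 + d 1] := by
  ext i
  fin_cases i <;> simp [Matrix.vecMul_eq_sum] <;> ring

theorem exists_mem_forall_vecMul_sub_nonneg_pos {S : Finset (Fin 2 → ℤ)} (hS : S.Nonempty) :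
    ∃ z₀ ∈ S, ∃ M : Matrix.GeneralLinearGroup (Fin 2) ℤ, ∀ z ∈ S, z ≠ z₀ →
      0 ≤ ((z - z₀) ᵥ* (M : Matrix (Fin 2) (Fin 2) ℤ)) 0 ∧
        0 < ((z - z₀) ᵥ* (M : Matrix (Fin 2) (Fin 2) ℤ)) 1 := by
  obtain ⟨b, hb⟩ := (S.image fun z => |z 0| + |z 1|).exists_le
  simp only [Finset.forall_mem_image] at hb
  -- The linear form `N * z 0 + z 1` is injective on `S`, so its minimum there is attained once.
  set N := 2 * b + 1
  obtain ⟨M, hM⟩ : ∃ M : Matrix.GeneralLinearGroup (Fin 2) ℤ, M.val = !![1 + N * N, N; N, 1] :=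
    ⟨.mk'' _ (by simp [Matrix.det_fin_two_of]), rfl⟩
  obtain ⟨z₀, hz₀, hmin⟩ := S.exists_min_image (fun z => N * z 0 + z 1) hS
  refine ⟨z₀, hz₀, M, fun z hz hne => ?_⟩
  have hd₀ : |(z - z₀) 0| < N := by grind [Pi.sub_apply]
  have hd₁ : |(z - z₀) 1| < N := by grind [Pi.sub_apply]
  have hnonneg : 0 ≤ N * (z - z₀) 0 + (z - z₀) 1 := by
    simp only [Pi.sub_apply]
    linarith [hmin z hz]
  have hpos : 0 < N * (z - z₀) 0 + (z - z₀) 1 := by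
    refine hnonneg.lt_of_ne' fun h => hne (sub_eq_zero.1 ?_)
    obtain ⟨h₀, h₁⟩ := eq_zero_of_mul_add_eq_zero_of_abs_lt hd₁ h
    ext i
    fin_cases i
    exacts [h₀, h₁]
  rw [hM, vecMul_one_add_mul_self]
  refine ⟨?_, hpos⟩
  have hN_pos : 0 < N := (abs_nonneg _).trans_lt hd₁
  simp only [Matrix.cons_val_zero]
  nlinarith [neg_lt_of_abs_lt hd₀]

end Lattice

namespace LaurentPoly

open Polynomial hiding X
open scoped Polynomial.Bivariate

section Subst

variable {R A B : Type*} [CommRing R] [CommRing A] [Algebra R A] [CommRing B] [Algebra R B] {n : ℕ}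

theorem coe_mono (z : Fin n → ℤ) : (mono R z : LaurentPoly R n) = AddMonoidAlgebra.single z 1 :=
  rfl

theorem subst_single (u : Fin n → Aˣ) (z : Fin n → ℤ) (c : R) :
    subst u (AddMonoidAlgebra.single z c) = c • ((∏ i, u i ^ z i : Aˣ) : A) := by
  simp [subst]

theorem subst_X (u : Fin n → Aˣ) (i : Fin n) : subst u (X R i : LaurentPoly R n) = u i := by
  simp [X, coe_mono, subst_single, Pi.single_apply, pow_ite]

theorem map_subst (f : A →ₐ[R] B) (u : Fin n → Aˣ) (P : LaurentPoly R n) :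
    f (subst u P) = subst (fun i => Units.map f (u i)) P := by
  induction P using AddMonoidAlgebra.induction_linear with
  | zero => simp
  | add P Q hP hQ => simp only [map_add, hP, hQ]
  | single z c => simp [subst_single, ← map_zpow]

end Subst

section Monomial

variable {R : Type*} [CommRing R] {n : ℕ}

/-- The monomial map `mono` as a group homomorphism, so that products of monomials can be computed
in the exponents. -/
noncomputable def monoHom (R : Type*) [CommRing R] (n : ℕ) :
    Multiplicative (Fin n → ℤ) →* (LaurentPoly R n)ˣ :=
  MonoidHom.mk' (fun z => mono R z.toAdd) fun z w => by
    ext1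
    simp [coe_mono, AddMonoidAlgebra.single_mul_single]

theorem prod_mono_zpow {ι : Type*} [Fintype ι] (m : ι → Fin n → ℤ) (z : ι → ℤ) :
    ∏ i, mono R (m i) ^ z i = mono R (∑ i, z i • m i) := by
  change ∏ i, monoHom R n (.ofAdd (m i)) ^ z i = monoHom R n (.ofAdd (∑ i, z i • m i))
  simp only [← map_zpow, ← map_prod, ofAdd_sum, ofAdd_zsmul]

theorem shift_changeVars_single (w : Fin n → ℤ) (M : Matrix.GeneralLinearGroup (Fin n) ℤ)
    (z : Fin n → ℤ) (c : R) :
    shift w (changeVars M (AddMonoidAlgebra.single z c)) =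
      AddMonoidAlgebra.single (w + Matrix.vecMul z (M : Matrix (Fin n) (Fin n) ℤ)) c := by
  have hrows : ∏ i, mono R ((M : Matrix (Fin n) (Fin n) ℤ) i) ^ z i =
      mono R (Matrix.vecMul z (M : Matrix (Fin n) (Fin n) ℤ)) := by
    rw [Matrix.vecMul_eq_sum]
    exact prod_mono_zpow _ z
  rw [shift, changeVars, subst_single, hrows, coe_mono, coe_mono,
    AddMonoidAlgebra.smul_single, AddMonoidAlgebra.single_mul_single, one_mul, smul_eq_mul, mul_one]

theorem shift_changeVars_eq_sum (w : Fin n → ℤ) (M : Matrix.GeneralLinearGroup (Fin n) ℤ)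
    (Q : LaurentPoly R n) :
    shift w (changeVars M Q) = ∑ z ∈ Q.coeff.support, AddMonoidAlgebra.single
      (w + Matrix.vecMul z (M : Matrix (Fin n) (Fin n) ℤ)) (Q.coeff z) := by
  conv_lhs => rw [← AddMonoidAlgebra.sum_coeff_single Q]
  simp only [← shift_changeVars_single, shift, changeVars, Finsupp.sum, map_sum, Finset.mul_sum]

theorem pderiv_add (i : Fin n) (P Q : LaurentPoly R n) :
    pderiv i (P + Q) = pderiv i P + pderiv i Q := by
  simp only [pderiv, AddMonoidAlgebra.coeff_add]
  exact Finsupp.sum_add_index' (by simp) fun z a b => by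
    rw [mul_add, AddMonoidAlgebra.single_add]

theorem pderiv_single (i : Fin n) (z : Fin n → ℤ) (c : R) :
    pderiv i (AddMonoidAlgebra.single z c : LaurentPoly R n) =
      AddMonoidAlgebra.single (z - Pi.single i 1) ((z i : R) * c) := by
  rw [pderiv, AddMonoidAlgebra.coeff_single]
  exact Finsupp.sum_single_index (by simp)

end Monomial

section Scale

variable {R A : Type*} [CommRing R] [CommRing A] [Algebra R A] {n : ℕ}

/-- The point `(v₁ u₁, …, vₙ uₙ)` at which `P` is evaluated when `v ∗ P` is evaluated at `u`; the
factor `v₀` is ignored. -/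
noncomputable def scalePoint (v : Fin (n + 1) → Rˣ) (u : Fin n → Aˣ) : Fin n → Aˣ :=
  fun i => Units.map (algebraMap R A) (v i.succ) * u i

theorem subst_scale (v : Fin (n + 1) → Rˣ) (u : Fin n → Aˣ) (P : LaurentPoly R n) :
    subst u (scale v P) = (v 0 : R) • subst (scalePoint v u) P := by
  have hpoint : (fun i => Units.map (subst u : LaurentPoly R n →ₐ[R] A)
      (Units.map (algebraMap R (LaurentPoly R n)) (v i.succ) * X R i)) = scalePoint v u := by
    ext i
    rw [scalePoint, map_mul, Units.val_mul, Units.val_mul, Units.coe_map, Units.coe_map,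
      Units.coe_map, Units.coe_map]
    simp only [MonoidHom.coe_coe, AlgHom.commutes, subst_X]
  rw [scale, map_smul, map_subst, hpoint]

theorem scale_add (v : Fin (n + 1) → Rˣ) (P Q : LaurentPoly R n) :
    scale v (P + Q) = scale v P + scale v Q := by
  simp only [scale, map_add, smul_add]

theorem scale_single (v : Fin (n + 1) → Rˣ) (z : Fin n → ℤ) (c : R) :
    scale v (AddMonoidAlgebra.single z c) =
      AddMonoidAlgebra.single z ((v 0 * ∏ i : Fin n, v i.succ ^ z i : Rˣ) * c) := by
  have hX : ∏ i, X R i ^ z i = mono R z := by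
    simp only [X, prod_mono_zpow]
    congr 1
    exact (pi_eq_sum_univ' z).symm
  rw [scale, subst_single]
  simp only [mul_zpow, Finset.prod_mul_distrib, hX, ← map_zpow, ← map_prod, Units.val_mul,
    Units.coe_map, MonoidHom.coe_coe, coe_mono, ← Algebra.smul_def, AddMonoidAlgebra.smul_single,
    smul_eq_mul, mul_one]
  ring_nf

theorem pderiv_scale (v : Fin (n + 1) → Rˣ) (i : Fin n) (P : LaurentPoly R n) :
    pderiv i (scale v P) = (v i.succ : R) • scale v (pderiv i P) := by
  induction P using AddMonoidAlgebra.induction_linear with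
  | zero => simp [scale, pderiv]
  | add P Q hP hQ => simp only [scale_add, pderiv_add, smul_add, hP, hQ]
  | single z c =>
    have hsingle : ∏ j : Fin n, v j.succ ^ (Pi.single i 1 : Fin n → ℤ) j = v i.succ := by
      simp [Pi.single_apply, pow_ite]
    have hprod : ∏ j : Fin n, v j.succ ^ z j =
        v i.succ * ∏ j : Fin n, v j.succ ^ (z - Pi.single i 1 : Fin n → ℤ) j := by
      simp only [← hsingle, ← Finset.prod_mul_distrib, ← zpow_add, Pi.sub_apply, add_sub_cancel]
    rw [scale_single, pderiv_single, pderiv_single, scale_single, AddMonoidAlgebra.smul_single,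
      hprod, smul_eq_mul]
    push_cast
    ring_nf

variable [Algebra R ℂ] {v : Fin (n + 1) → Rˣ} {P : LaurentPoly R n} {u : Fin n → ℂˣ}

theorem mem_zeroLocus_scale : u ∈ zeroLocus (scale v P) ↔ scalePoint v u ∈ zeroLocus P := by
  change subst u (scale v P) = 0 ↔ subst (scalePoint v u) P = 0
  rw [subst_scale]
  exact smul_eq_zero_iff_eq (v 0)

theorem scalePoint_mem_singularLocus (hu : u ∈ singularLocus (scale v P)) :
    scalePoint v u ∈ singularLocus P := by
  refine ⟨mem_zeroLocus_scale.1 hu.1, fun F hF i => ?_⟩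
  let vC : Fin (n + 1) → ℂˣ := fun j => Units.map (algebraMap R ℂ) (v j)
  have hvC (t : Fin n → ℂˣ) : scalePoint vC t = scalePoint v t := rfl
  have hscale : subst u (pderiv i (scale vC F)) = 0 := by
    refine hu.2 _ (fun t ht => ?_) i
    rw [subst_scale, hvC, hF _ (mem_zeroLocus_scale.1 ht), smul_zero]
  rw [pderiv_scale, map_smul, subst_scale, hvC] at hscale
  exact (smul_eq_zero_iff_eq (vC 0)).1 ((smul_eq_zero_iff_eq (vC i.succ)).1 hscale)

end Scale

section Bivariate

variable {R A B : Type*} [CommRing R] [CommRing A] [Algebra R A] [CommRing B] [Algebra R B]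

/-- A polynomial in two variables as a Laurent polynomial, with coefficients extended from `R` to
`A`. The inner variable of `R[X][Y]` becomes the coordinate `x` of index `0`, the outer one the
coordinate `y` of index `1`. -/
noncomputable def ofBivariate (R A : Type*) [CommRing R] [CommRing A] [Algebra R A] :
    R[X][Y] →ₐ[R] LaurentPoly A 2 :=
  aevalAeval (X A (0 : Fin 2) : LaurentPoly A 2) (X A (1 : Fin 2) : LaurentPoly A 2)

theorem subst_ofBivariate [Algebra A B] [IsScalarTower R A B] (u : Fin 2 → Bˣ) (p : R[X][Y]) :
    subst u (ofBivariate R A p) = aevalAeval (u 0 : B) (u 1 : B) p := by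
  have h := map_aevalAeval ((subst u : LaurentPoly A 2 →ₐ[A] B).restrictScalars R)
    (X A (0 : Fin 2) : LaurentPoly A 2) (X A (1 : Fin 2) : LaurentPoly A 2) p
  simpa only [ofBivariate, AlgHom.restrictScalars_apply, subst_X] using h

theorem ofBivariate_monomial (i j : ℕ) (c : R) :
    ofBivariate R A (monomial j (monomial i c)) =
      AddMonoidAlgebra.single ![(i : ℤ), (j : ℤ)] (algebraMap R A c) := by
  have hexp : i • Pi.single 0 1 + j • Pi.single 1 1 = ![(i : ℤ), (j : ℤ)] := by
    ext k
    fin_cases k <;> simp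
  have hmonomial : monomial j (monomial i c) =
      algebraMap R R[X][Y] c * (C Polynomial.X ^ i * Polynomial.X ^ j) := by
    rw [← C_mul_X_pow_eq_monomial, ← C_mul_X_pow_eq_monomial]
    simp [mul_assoc]
  rw [hmonomial, map_mul, AlgHom.commutes, map_mul, map_pow, map_pow]
  simp only [ofBivariate, aevalAeval_C, aeval_X, aevalAeval_Y]
  rw [X, X, coe_mono, coe_mono, AddMonoidAlgebra.single_pow, AddMonoidAlgebra.single_pow,
    AddMonoidAlgebra.single_mul_single, hexp]
  simp

theorem pderiv_one_ofBivariate (p : R[X][Y]) :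
    pderiv 1 (ofBivariate R A p) = ofBivariate R A (derivative p) := by
  induction p using Polynomial.induction_on' with
  | add p q hp hq => simp only [map_add, pderiv_add, hp, hq]
  | monomial j f =>
    induction f using Polynomial.induction_on' with
    | add f g hf hg => simp only [map_add, pderiv_add, hf, hg]
    | monomial i c =>
      rw [ofBivariate_monomial, pderiv_single, derivative_monomial]
      cases j with
      | zero => simp
      | succ j =>
        have hcoeff : monomial i c * ((j + 1 : ℕ) : R[X]) =
            monomial i (c * ((j + 1 : ℕ) : R)) := by
          rw [← C_eq_natCast, monomial_mul_C]
        rw [hcoeff, ofBivariate_monomial]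
        congr 1
        · ext k
          fin_cases k <;> simp
        · simp [mul_comm]

end Bivariate

section SingularFibres

variable {R : Type*} [CommRing R] [IsDomain R] [CharZero R] [Algebra R ℂ] {p : R[X][Y]}

theorem exists_forall_aeval_ne_zero_notMem_singularLocus (hp : p ≠ 0) :
    ∃ r : R[X], r ≠ 0 ∧ ∀ u : Fin 2 → ℂˣ, aeval (u 0 : ℂ) r ≠ 0 →
      u ∉ singularLocus (ofBivariate R R p) := by
  obtain ⟨F, ⟨k, hpF⟩, A, B, r, hr, hbezout⟩ := exists_dvd_pow_and_mul_add_mul_derivative_eq_C hp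
  refine ⟨r, hr, fun u hru hu => hru ?_⟩
  have hF (t : Fin 2 → ℂˣ) (ht : t ∈ zeroLocus (ofBivariate R R p)) :
      aevalAeval (t 0 : ℂ) (t 1 : ℂ) F = 0 := by
    change subst t (ofBivariate R R p) = 0 at ht
    rw [subst_ofBivariate] at ht
    refine eq_zero_of_pow_eq_zero (n := k) ?_
    rw [← map_pow, ← zero_dvd_iff, ← ht]
    exact map_dvd _ hpF
  have hF' : aevalAeval (u 0 : ℂ) (u 1 : ℂ) (derivative F) = 0 := by
    have h := hu.2 (ofBivariate R ℂ F) (fun t ht => by rw [subst_ofBivariate, hF t ht]) 1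
    rwa [pderiv_one_ofBivariate, subst_ofBivariate] at h
  calc aeval (u 0 : ℂ) r
      = aevalAeval (u 0 : ℂ) (u 1 : ℂ) (C r) := (aevalAeval_C _ _ r).symm
    _ = 0 := by rw [← hbezout, map_add, map_mul, map_mul, hF u hu.1, hF', mul_zero, mul_zero,
        add_zero]

theorem exists_forall_norm_eq_notMem_singularLocus_and_norm_lt [FaithfulSMul R ℂ] (hp : p ≠ 0) :
    ∃ n : ℕ, n ≠ 0 ∧ ∃ T : ℝ, ∀ u : Fin 2 → ℂˣ, ‖(u 0 : ℂ)‖ = n →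
      u ∉ singularLocus (ofBivariate R R p) ∧
        (u ∈ zeroLocus (ofBivariate R R p) → ‖(u 1 : ℂ)‖ < T) := by
  obtain ⟨r, hr, hsing⟩ := exists_forall_aeval_ne_zero_notMem_singularLocus hp
  obtain ⟨n, hn, hcircle⟩ := exists_nat_forall_norm_eq_aeval_ne_zero (K := ℂ)
    (mul_ne_zero hr (leadingCoeff_ne_zero.2 hp))
  simp only [map_mul, mul_ne_zero_iff] at hcircle
  obtain ⟨T, hT⟩ := exists_forall_eval_map_eq_zero_norm_lt (isCompact_sphere (0 : ℂ) n)
    (fun x => (aeval x : R[X] →ₐ[R] ℂ).toRingHom)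
    (fun b => b.continuous_aeval.continuousOn) p
    (fun x hx => (hcircle x (mem_sphere_zero_iff_norm.1 hx)).2)
  refine ⟨n, hn, T, fun u hu => ⟨hsing u (hcircle _ hu).1, fun hzero => ?_⟩⟩
  refine hT _ (mem_sphere_zero_iff_norm.2 hu) _ ?_
  rw [eval_map_aeval, ← subst_ofBivariate (A := R)]
  exact hzero

end SingularFibres

section NormalForm

open scoped Matrix

variable {R : Type*} [CommRing R]

theorem single_eq_ofBivariate_Y_mul {e : Fin 2 → ℤ} (he₀ : 0 ≤ e 0) (he₁ : 0 < e 1) (c : R) :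
    AddMonoidAlgebra.single e c = ofBivariate R R
      (Y * monomial (e 1 - 1).toNat (monomial (e 0).toNat c)) := by
  have hexp : e = ![((e 0).toNat : ℤ), (((e 1 - 1).toNat + 1 : ℕ) : ℤ)] := by
    ext k
    fin_cases k <;> simp <;> omega
  rw [X_mul_monomial, ofBivariate_monomial, ← hexp, Algebra.algebraMap_self_apply]

theorem exists_shift_changeVars_eq_ofBivariate {Q : LaurentPoly R 2} (hQ : Q ≠ 0) :
    ∃ (w : Fin 2 → ℤ) (M : Matrix.GeneralLinearGroup (Fin 2) ℤ) (c : R) (H : R[X][Y]),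
      c ≠ 0 ∧ shift w (changeVars M Q) = ofBivariate R R (C (C c) + Y * H) := by
  have hsupp : Q.coeff.support.Nonempty :=
    Finsupp.support_nonempty_iff.2 (by simpa using hQ)
  obtain ⟨z₀, hz₀, M, hM⟩ := exists_mem_forall_vecMul_sub_nonneg_pos hsupp
  let e (z : Fin 2 → ℤ) : Fin 2 → ℤ := (z - z₀) ᵥ* (M : Matrix (Fin 2) (Fin 2) ℤ)
  have he (z : Fin 2 → ℤ) : -(z₀ ᵥ* (M : Matrix (Fin 2) (Fin 2) ℤ)) + z ᵥ* M = e z := by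
    rw [neg_add_eq_sub, ← Matrix.sub_vecMul]
  refine ⟨-(z₀ ᵥ* M), M, Q.coeff z₀, ∑ z ∈ Q.coeff.support.erase z₀,
    monomial (e z 1 - 1).toNat (monomial (e z 0).toNat (Q.coeff z)),
    Finsupp.mem_support_iff.1 hz₀, ?_⟩
  rw [shift_changeVars_eq_sum, ← Finset.add_sum_erase _ _ hz₀, map_add, Finset.mul_sum, map_sum]
  congr 1
  · have hez₀ : e z₀ = ![((0 : ℕ) : ℤ), ((0 : ℕ) : ℤ)] := by
      ext i
      fin_cases i <;> simp [e]
    rw [he, hez₀, ← monomial_zero_left, ← monomial_zero_left,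
      ofBivariate_monomial, Algebra.algebraMap_self_apply]
  · refine Finset.sum_congr rfl fun z hz => ?_
    obtain ⟨hne, hz⟩ := Finset.mem_erase.1 hz
    rw [he, single_eq_ofBivariate_Y_mul (hM z hz hne).1 (hM z hz hne).2]

end NormalForm

section Integrality

theorem scale_ofBivariate {R : Type*} [CommRing R] (v : Fin 3 → Rˣ) (p : R[X][Y]) :
    scale v (ofBivariate R R p) = (v 0 : R) • aevalAeval
      ((v 1 : R) • (X R (0 : Fin 2) : LaurentPoly R 2))
      ((v 2 : R) • (X R (1 : Fin 2) : LaurentPoly R 2)) p := by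
  rw [scale, subst_ofBivariate]
  simp [Algebra.smul_def]

theorem exists_forall_scale_mem_onePlusYIntPoly (c : ℚˣ) (H : ℚ[X][Y]) :
    ∃ d : ℤ, d ≠ 0 ∧ ∀ (v : Fin 3 → ℚˣ) (n m : ℤ), v 0 = c⁻¹ → (v 1 : ℚ) = n → (v 2 : ℚ) = d * m →
      scale v (ofBivariate ℚ ℚ (C (C (c : ℚ)) + Y * H)) ∈ onePlusYIntPoly := by
  obtain ⟨d, hd, G, hG⟩ := exists_map_mapRingHom_eq_CC_mul (nonZeroDivisors ℤ)
    (C (C (c⁻¹ : ℚ)) * H)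
  refine ⟨d, nonZeroDivisors.ne_zero hd, fun v n m hv₀ hv₁ hv₂ => ?_⟩
  let x : LaurentPoly ℚ 2 := (v 1 : ℚ) • (X ℚ (0 : Fin 2) : LaurentPoly ℚ 2)
  let y : LaurentPoly ℚ 2 := (v 2 : ℚ) • (X ℚ (1 : Fin 2) : LaurentPoly ℚ 2)
  have hx : x = n • (X ℚ (0 : Fin 2) : LaurentPoly ℚ 2) := by
    simp only [x, hv₁, Int.cast_smul_eq_zsmul]
  have hy : y = (d * m) • (X ℚ (1 : Fin 2) : LaurentPoly ℚ 2) := by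
    simp only [y, hv₂, ← Int.cast_mul, Int.cast_smul_eq_zsmul]
  let F : MvPolynomial (Fin 2) ℤ :=
    m • aevalAeval (n • MvPolynomial.X 0) ((d * m) • MvPolynomial.X 1) G
  have hG' : aevalAeval x y G = ((d : ℚ) * (c⁻¹ : ℚ)) • aevalAeval x y H := by
    rw [← aevalAeval_map_mapRingHom (S := ℚ), hG, ← mul_assoc, ← C_mul, ← C_mul, map_mul,
      aevalAeval_C, aeval_C, Algebra.smul_def]
    rfl
  have hF : MvPolynomial.aeval (fun i => (X ℚ i : LaurentPoly ℚ 2)) F =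
      ((m : ℚ) * (d * (c⁻¹ : ℚ))) • aevalAeval x y H := by
    simp only [F, map_zsmul, map_aevalAeval, MvPolynomial.aeval_X, ← hx, ← hy, hG',
      ← Int.cast_smul_eq_zsmul ℚ m, smul_smul]
  have hconst : (v 0 : ℚ) * c = 1 := by simp [hv₀]
  have hlin : (v 0 : ℚ) * v 2 = m * (d * (c⁻¹ : ℚ)) := by
    rw [hv₀, hv₂, Units.val_inv_eq_inv_val]
    ring
  refine ⟨F, ?_⟩
  calc scale v (ofBivariate ℚ ℚ (C (C (c : ℚ)) + Y * H))
      = (v 0 : ℚ) • (algebraMap ℚ _ (c : ℚ) +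
          (v 2 : ℚ) • (X ℚ (1 : Fin 2) : LaurentPoly ℚ 2) * aevalAeval x y H) := by
        rw [scale_ofBivariate, map_add, map_mul, aevalAeval_C, aeval_C, aevalAeval_Y]
    _ = 1 + ((m : ℚ) * (d * (c⁻¹ : ℚ))) •
          ((X ℚ (1 : Fin 2) : LaurentPoly ℚ 2) * aevalAeval x y H) := by
        rw [smul_add, Algebra.algebraMap_eq_smul_one, smul_smul, hconst, one_smul, smul_mul_assoc,
          smul_smul, hlin]
    _ = 1 + (X ℚ (1 : Fin 2) : LaurentPoly ℚ 2) *
          MvPolynomial.aeval (fun i => (X ℚ i : LaurentPoly ℚ 2)) F := by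
        rw [hF, mul_smul_comm]

end Integrality

section Scaling

theorem exists_scale_ofBivariate {c : ℚ} (hc : c ≠ 0) (H : ℚ[X][Y]) :
    ∃ v : Fin 3 → ℚˣ, scale v (ofBivariate ℚ ℚ (C (C c) + Y * H)) ∈ onePlusYIntPoly ∧
      zeroLocus (scale v (ofBivariate ℚ ℚ (C (C c) + Y * H))) ∩ unitTorus 2 = ∅ ∧
      deningerPath (scale v (ofBivariate ℚ ℚ (C (C c) + Y * H))) ∩
        singularLocus (scale v (ofBivariate ℚ ℚ (C (C c) + Y * H))) = ∅ := by
  obtain ⟨d, hd, hint⟩ := exists_forall_scale_mem_onePlusYIntPoly (Units.mk0 c hc) H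
  obtain ⟨n, hn, T, hT⟩ :=
    exists_forall_norm_eq_notMem_singularLocus_and_norm_lt (C_C_add_Y_mul_ne_zero hc H)
  obtain ⟨m, hm⟩ := exists_nat_gt (max T 0)
  obtain ⟨hmT, hm₀⟩ := max_lt_iff.1 hm
  let v : Fin 3 → ℚˣ := ![(Units.mk0 c hc)⁻¹, Units.mk0 (n : ℚ) (Nat.cast_ne_zero.2 hn),
    Units.mk0 ((d : ℚ) * m) (mul_ne_zero (Int.cast_ne_zero.2 hd) (by exact_mod_cast hm₀.ne'))]
  have hx (u : Fin 2 → ℂˣ) (hu : ‖(u 0 : ℂ)‖ = 1) : ‖(scalePoint v u 0 : ℂ)‖ = n := by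
    simp [scalePoint, v, hu]
  have hy (u : Fin 2 → ℂˣ) (hu : ‖(u 1 : ℂ)‖ = 1) : T ≤ ‖(scalePoint v u 1 : ℂ)‖ := by
    have hd₁ : (1 : ℝ) ≤ |(d : ℝ)| := by exact_mod_cast Int.one_le_abs hd
    calc T ≤ 1 * m := by linarith
      _ ≤ |(d : ℝ)| * m := by gcongr
      _ = ‖(scalePoint v u 1 : ℂ)‖ := by simp [scalePoint, v, hu]
  refine ⟨v, hint v n m rfl (by simp [v]) (by simp [v]),
    Set.eq_empty_of_forall_notMem fun u ⟨hzero, htorus⟩ => ?_,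
    Set.eq_empty_of_forall_notMem fun u ⟨hpath, hsing⟩ => ?_⟩
  · exact ((hT _ (hx u (htorus 0))).2 (mem_zeroLocus_scale.1 hzero)).not_ge (hy u (htorus 1))
  · exact (hT _ (hx u hpath.2.1)).1 (scalePoint_mem_singularLocus hsing)

end Scaling

end LaurentPoly

theorem mainTheorem6 (Q : LaurentPoly ℚ 2) (hQ : Q ≠ 0) :
    ∃ α : LaurentPoly.Transformation ℚ 2,
      α.act Q ∈ LaurentPoly.onePlusYIntPoly ∧
      LaurentPoly.zeroLocus (α.act Q) ∩ LaurentPoly.unitTorus 2 = ∅ ∧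
      LaurentPoly.deningerPath (α.act Q) ∩ LaurentPoly.singularLocus (α.act Q) = ∅ := by
  obtain ⟨w, M, c, H, hc, hQH⟩ := LaurentPoly.exists_shift_changeVars_eq_ofBivariate hQ
  obtain ⟨v, hv⟩ := LaurentPoly.exists_scale_ofBivariate hc H
  exact ⟨⟨v, w, M⟩, by simpa only [LaurentPoly.Transformation.act, hQH] using hv⟩
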